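/- Let $d\in\{2,3\}$ and let $\Omega\subset\mathbb{R}^d$ be a bounded open set (for instance, a Lipschitz domain with polyhedral boundary) with a conforming triangulation $\mathcal{T}$ into finitely many non-degenerate $d$-simplices. Let $W_0^{1,2}(\Omega)^d$ be the closure of $C_0^\infty(\Omega)^d$ in $W^{1,2}(\Omega)^d$, and write $\|\mathbf{V}\|_{1,2}:=\|\nabla\mathbf{V}\|_{L^2(\Omega)}$ and $\mathrm{D}\mathbf{V}:=\frac12(\nabla\mathbf{V}+(\nabla\mathbf{V})^{\mathrm T})$; matrices carry the Frobenius inner product and norm. For $K\in\mathcal T$ let $\mathbb{P}_{\mathbb V}(K),\mathbb{P}_{\mathbb Q}(K)$ be linear spaces of polynomials with $\mathbb{P}_1^d\subseteq\mathbb{P}_{\mathbb V}(K)\subseteq\mathbb{P}_{i^\star}^d$ and $\mathbb{P}_0\subseteq\mathbb{P}_{\mathbb Q}(K)\subseteq\mathbb{P}_{j^\star}$ for some $i^\star\ge j^\star\ge 0$, where $\mathbb{P}_m$ denotes the polynomials of total degree at most $m$, and put $$\mathbb V:=\{\mathbf V\in W_0^{1,2}(\Omega)^d:\mathbf V|_K\in\mathbb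 P_{\mathbb V}(K)\ \forall K\in\mathcal T\},\qquad \mathbb Q:=\{Q\in L^\infty(\Omega):Q|_K\in\mathbb P_{\mathbb Q}(K)\ \forall K\in\mathcal T\},$$ $$\mathbb Q_0:=\Big\{Q\in\mathbb Q:\int_\Omega Q\,dx=0\Big\},\qquad \mathbb V_0:=\Big\{\mathbf V\in\mathbb V:\int_\Omega Q\,\mathrm{div}\,\mathbf V\,dx=0\ \forall Q\in\mathbb Q\Big\}.$$ Let $\sigma\ge 0$, $\nu>0$, let $n\ge 1$ be an integer, let $\mathbf f\in L^2(\Omega)^d$, and set $\mu_n(t):=\frac{\sigma}{\sqrt{t+n^{-2}}}+2\nu$ for $t\ge0$, $$a_n(\mathbf U;\mathbf V,\mathbf W):=\int_\Omega\mu_n(|\mathrm D\mathbf U|^2)\,\mathrm D\mathbf V:\mathrm D\mathbf W\,dx,\qquad b(Q,\mathbf V):=-\int_\Omega Q\,\mathrm{div}\,\mathbf V\,dx,$$ $$\mathrm H_n(\mathbf U):=\int_\Omega\varphi_n(|\mathrm D\mathbf U|^2)\,dx-\int_\Omega\mathbf f\cdot\mathbf U\,dx,\qquad \varphi_n(s):=\frac12\int_0^s\mu_n(t)\,dt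 .$$ Let $(\mathbf U,P)\in\mathbb V\times\mathbb Q_0$ be a solution of the regularised, convection-free discrete Bingham problem $$a_n(\mathbf U;\mathbf U,\mathbf V)+b(P,\mathbf V)+b(Q,\mathbf U)=\int_\Omega\mathbf f\cdot\mathbf V\,dx\qquad\forall(\mathbf V,Q)\in\mathbb V\times\mathbb Q,$$ and let $\mathbf U^0\in\mathbb V_0$ and $(\mathbf U^{\ell+1},P^{\ell+1})\in\mathbb V\times\mathbb Q_0$, $\ell=0,1,2,\dots$, be generated by the Kačanov iteration $$a_n(\mathbf U^\ell;\mathbf U^{\ell+1},\mathbf V)+b(P^{\ell+1},\mathbf V)+b(Q,\mathbf U^{\ell+1})=\int_\Omega\mathbf f\cdot\mathbf V\,dx\qquad\forall(\mathbf V,Q)\in\mathbb V\times\mathbb Q.$$ Then, for all $\ell=0,1,2,\dots$, $$\|\mathbf U^\ell-\mathbf U\|_{1,2}\le\frac{\sigma n+2\nu}{\nu}\,\|\mathbf U^{\ell+1}-\mathbf U^\ell\|_{1,2},$$ $$\mathrm H_n(\mathbf U^{\ell+1})-\mathrm H_n(\mathbf U)\le q_{\rm con}\,\big(\mathrm H_n(\mathbf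 U^\ell)-\mathrm H_n(\mathbf U)\big),\qquad q_{\rm con}:=1-\frac{\nu^3}{(\sqrt3\,\sigma n+2\nu)(\sigma n+2\nu)^2},$$ and $q_{\rm con}\in(0,1)$. -/

import Mathlib

open MeasureTheory
open scoped ENNReal ContDiff

noncomputable section

namespace BinghamFE

/-- The Euclidean space `ℝ^d`. -/
abbrev Vec (d : ℕ) := EuclideanSpace ℝ (Fin d)

/-- Real `d × d` matrices, with the Frobenius inner product and the Frobenius norm. -/
abbrev Mat (d : ℕ) := EuclideanSpace ℝ (Fin d × Fin d)

variable {d : ℕ}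

/-! ### Sobolev spaces -/

/-- `L²(Ω)^d`. -/
abbrev L2Vec (Ω : Set (Vec d)) : Type := Lp (Vec d) 2 (volume.restrict Ω)

/-- `L²(Ω)^{d×d}`. -/
abbrev L2Mat (Ω : Set (Vec d)) : Type := Lp (Mat d) 2 (volume.restrict Ω)

/-- The classical partial derivative `∂_j φ` of a scalar function. -/
def partialDeriv (j : Fin d) (φ : Vec d → ℝ) (x : Vec d) : ℝ :=
  fderiv ℝ φ x (EuclideanSpace.single j 1)

/-- The classical gradient of a vector field, `(∇φ)_{ij} = ∂_j φ_i`. -/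
def classicalGrad (φ : Vec d → Vec d) (x : Vec d) : Mat d :=
  WithLp.toLp 2 fun ij => fderiv ℝ φ x (EuclideanSpace.single ij.2 1) ij.1

/-- `φ ∈ C_0^∞(Ω; F)`: smooth with compact support contained in `Ω`. -/
structure IsTestFunction {F : Type*} [NormedAddCommGroup F] [NormedSpace ℝ F]
    (Ω : Set (Vec d)) (φ : Vec d → F) : Prop where
  smooth : ContDiff ℝ ∞ φ
  compact : HasCompactSupport φ
  support : tsupport φ ⊆ Ω

theorem IsTestFunction.add {F : Type*} [NormedAddCommGroup F] [NormedSpace ℝ F]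
    {Ω : Set (Vec d)} {φ ψ : Vec d → F} (hφ : IsTestFunction Ω φ) (hψ : IsTestFunction Ω ψ) :
    IsTestFunction Ω (φ + ψ) :=
  ⟨hφ.smooth.add hψ.smooth, hφ.compact.add hψ.compact,
    (tsupport_add φ ψ).trans (Set.union_subset hφ.support hψ.support)⟩

theorem IsTestFunction.const_smul {F : Type*} [NormedAddCommGroup F] [NormedSpace ℝ F]
    {Ω : Set (Vec d)} {φ : Vec d → F} (hφ : IsTestFunction Ω φ) (c : ℝ) :
    IsTestFunction Ω (c • φ) := by
  refine ⟨hφ.smooth.const_smul c, hφ.compact.mono ?_, (closure_mono ?_).trans hφ.support⟩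
  · intro x hx h
    exact hx (by simp [h])
  · intro x hx h
    exact hx (by simp [h])

theorem isTestFunction_zero {F : Type*} [NormedAddCommGroup F] [NormedSpace ℝ F]
    (Ω : Set (Vec d)) : IsTestFunction Ω (0 : Vec d → F) :=
  ⟨contDiff_const, HasCompactSupport.zero, by simp⟩

/-- `G` is the weak gradient of `u` in `Ω`: `∫_Ω u_i ∂_j φ = - ∫_Ω G_{ij} φ` for all scalar test
functions `φ ∈ C_0^∞(Ω)` and all `i, j`. -/
def IsWeakGrad (Ω : Set (Vec d)) (u : L2Vec Ω) (G : L2Mat Ω) : Prop :=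
  ∀ φ : Vec d → ℝ, IsTestFunction Ω φ → ∀ i j : Fin d,
    ∫ x in Ω, u x i * partialDeriv j φ x = - ∫ x in Ω, G x (i, j) * φ x

/-- A Sobolev function is represented by the pair `(u, ∇u)` of the function and its weak gradient
(the second component is determined by the first one). -/
abbrev SobolevPair (Ω : Set (Vec d)) : Type := L2Vec Ω × L2Mat Ω

/-- The elements `(φ, ∇φ)` with `φ ∈ C_0^∞(Ω)^d`. -/
def testPairs (Ω : Set (Vec d)) : Submodule ℝ (SobolevPair Ω) where
  carrier := {w | ∃ φ : Vec d → Vec d, IsTestFunction Ω φ ∧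
    w.1 =ᵐ[volume.restrict Ω] φ ∧ w.2 =ᵐ[volume.restrict Ω] classicalGrad φ}
  zero_mem' := by
    refine ⟨0, isTestFunction_zero Ω, Lp.coeFn_zero _ _ _, ?_⟩
    filter_upwards [Lp.coeFn_zero (Mat d) 2 (volume.restrict Ω)] with x hx
    rw [Prod.snd_zero, hx]
    ext ij
    simp [classicalGrad]
  add_mem' := by
    rintro v w ⟨φ, hφ, h1, h2⟩ ⟨ψ, hψ, h3, h4⟩
    refine ⟨φ + ψ, hφ.add hψ, ?_, ?_⟩
    · filter_upwards [h1, h3, Lp.coeFn_add v.1 w.1] with x a b c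
      rw [Prod.fst_add, c, Pi.add_apply, Pi.add_apply, a, b]
    · filter_upwards [h2, h4, Lp.coeFn_add v.2 w.2] with x a b c
      rw [Prod.snd_add, c, Pi.add_apply, a, b]
      ext ij
      simp [classicalGrad, fderiv_add (hφ.smooth.differentiable (by simp) x)
        (hψ.smooth.differentiable (by simp) x)]
  smul_mem' := by
    rintro c v ⟨φ, hφ, h1, h2⟩
    refine ⟨c • φ, hφ.const_smul c, ?_, ?_⟩
    · filter_upwards [h1, Lp.coeFn_smul c v.1] with x a b
      rw [Prod.smul_fst, b, Pi.smul_apply, Pi.smul_apply, a]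
    · filter_upwards [h2, Lp.coeFn_smul c v.2] with x a b
      rw [Prod.smul_snd, b, Pi.smul_apply, a]
      ext ij
      simp [classicalGrad, fderiv_const_smul (hφ.smooth.differentiable (by simp) x)]

theorem integrable_coord_mul {ι : Type*} [Fintype ι] {μ : Measure (Vec d)}
    (u : Lp (EuclideanSpace ℝ ι) 2 μ) [IsFiniteMeasureOnCompacts μ] (i : ι) {g : Vec d → ℝ}
    (hg : Continuous g) (hc : HasCompactSupport g) : Integrable (fun x => u x i * g x) μ := by
  have h1 : MemLp (fun x => u x i) 2 μ :=
    (EuclideanSpace.proj i : EuclideanSpace ℝ ι →L[ℝ] ℝ).comp_memLp' (Lp.memLp u)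
  exact h1.integrable_mul (hg.memLp_of_hasCompactSupport hc : MemLp g 2 μ)

theorem IsTestFunction.continuous_partialDeriv {Ω : Set (Vec d)} {φ : Vec d → ℝ}
    (hφ : IsTestFunction Ω φ) (j : Fin d) : Continuous (partialDeriv j φ) :=
  (hφ.smooth.continuous_fderiv (by simp)).clm_apply continuous_const

theorem IsTestFunction.hasCompactSupport_partialDeriv {Ω : Set (Vec d)} {φ : Vec d → ℝ}
    (hφ : IsTestFunction Ω φ) (j : Fin d) : HasCompactSupport (partialDeriv j φ) :=
  hφ.compact.fderiv_apply (𝕜 := ℝ) _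

/-- The Sobolev space `W^{1,2}(Ω)^d`. -/
def W12 (Ω : Set (Vec d)) : Submodule ℝ (SobolevPair Ω) where
  carrier := {w | IsWeakGrad Ω w.1 w.2}
  zero_mem' := by
    intro φ _ i j
    have h1 : ∫ x in Ω, ((0 : L2Vec Ω) x) i * partialDeriv j φ x = ∫ x in Ω, (0 : ℝ) := by
      refine integral_congr_ae ?_
      filter_upwards [Lp.coeFn_zero (Vec d) 2 (volume.restrict Ω)] with x hx
      rw [hx]
      simp
    have h2 : ∫ x in Ω, ((0 : L2Mat Ω) x) (i, j) * φ x = ∫ x in Ω, (0 : ℝ) := by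
      refine integral_congr_ae ?_
      filter_upwards [Lp.coeFn_zero (Mat d) 2 (volume.restrict Ω)] with x hx
      rw [hx]
      simp
    rw [Prod.fst_zero, Prod.snd_zero, h1, h2]
    simp
  add_mem' := by
    intro v w hv hw φ hφ i j
    have h1 : ∫ x in Ω, ((v.1 + w.1 : L2Vec Ω) x) i * partialDeriv j φ x =
        ∫ x in Ω, (v.1 x i * partialDeriv j φ x + w.1 x i * partialDeriv j φ x) := by
      refine integral_congr_ae ?_
      filter_upwards [Lp.coeFn_add v.1 w.1] with x hx
      rw [hx]
      simp [add_mul]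
    have h2 : ∫ x in Ω, ((v.2 + w.2 : L2Mat Ω) x) (i, j) * φ x =
        ∫ x in Ω, (v.2 x (i, j) * φ x + w.2 x (i, j) * φ x) := by
      refine integral_congr_ae ?_
      filter_upwards [Lp.coeFn_add v.2 w.2] with x hx
      rw [hx]
      simp [add_mul]
    have c := hφ.continuous_partialDeriv j
    have s := hφ.hasCompactSupport_partialDeriv j
    rw [Prod.fst_add, Prod.snd_add, h1, h2,
      integral_add (integrable_coord_mul _ _ c s) (integrable_coord_mul _ _ c s),
      integral_add (integrable_coord_mul _ _ hφ.smooth.continuous hφ.compact)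
        (integrable_coord_mul _ _ hφ.smooth.continuous hφ.compact), hv φ hφ i j, hw φ hφ i j]
    ring
  smul_mem' := by
    intro a v hv φ hφ i j
    have h1 : ∫ x in Ω, ((a • v.1 : L2Vec Ω) x) i * partialDeriv j φ x =
        ∫ x in Ω, a * (v.1 x i * partialDeriv j φ x) := by
      refine integral_congr_ae ?_
      filter_upwards [Lp.coeFn_smul a v.1] with x hx
      simp [hx, mul_assoc]
    have h2 : ∫ x in Ω, ((a • v.2 : L2Mat Ω) x) (i, j) * φ x =
        ∫ x in Ω, a * (v.2 x (i, j) * φ x) := by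
      refine integral_congr_ae ?_
      filter_upwards [Lp.coeFn_smul a v.2] with x hx
      simp [hx, mul_assoc]
    rw [Prod.smul_fst, Prod.smul_snd, h1, h2, integral_const_mul, integral_const_mul,
      hv φ hφ i j]
    ring

/-- The space `W_0^{1,2}(Ω)^d`: the closure of `C_0^∞(Ω)^d` in `W^{1,2}(Ω)^d`. -/
def W012 (Ω : Set (Vec d)) : Submodule ℝ (SobolevPair Ω) :=
  W12 Ω ⊓ (testPairs Ω).topologicalClosure

/-- The norm `‖U‖_{1,2} = ‖∇U‖_2`. -/
def norm12 {Ω : Set (Vec d)} (U : SobolevPair Ω) : ℝ := ‖U.2‖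

/-- The symmetric part of a matrix. -/
def symPart (G : Mat d) : Mat d :=
  WithLp.toLp 2 fun ij => (1 / 2 : ℝ) * (G (ij.1, ij.2) + G (ij.2, ij.1))

/-- The symmetric velocity gradient `D U`. -/
def symGrad {Ω : Set (Vec d)} (U : SobolevPair Ω) (x : Vec d) : Mat d := symPart (U.2 x)

/-- The divergence `div U`. -/
def divergence {Ω : Set (Vec d)} (U : SobolevPair Ω) (x : Vec d) : ℝ := ∑ i, U.2 x (i, i)

/-! ### Finite element spaces -/

/-- A conforming triangulation of `Ω`: finitely many nondegenerate `d`-simplices, each given by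
its set of `d + 1` vertices, that cover the closure of `Ω`, whose interiors lie in `Ω`, and any two
of which meet in the simplex spanned by their common vertices (possibly empty). -/
structure Triangulation (Ω : Set (Vec d)) where
  elems : Finset (Finset (Vec d))
  card_eq : ∀ K ∈ elems, K.card = d + 1
  indep : ∀ K ∈ elems, AffineIndependent ℝ ((↑) : K → Vec d)
  cover : (⋃ K ∈ elems, convexHull ℝ (K : Set (Vec d))) = closure Ω
  interior_subset : ∀ K ∈ elems, interior (convexHull ℝ (K : Set (Vec d))) ⊆ Ω
  conforming : ∀ K ∈ elems, ∀ L ∈ elems,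
    convexHull ℝ (K : Set (Vec d)) ∩ convexHull ℝ (L : Set (Vec d)) =
      convexHull ℝ ((K : Set (Vec d)) ∩ (L : Set (Vec d)))

/-- Scalar polynomials in `d` variables of total degree at most `m`. -/
def scalarPoly (d m : ℕ) : Submodule ℝ (MvPolynomial (Fin d) ℝ) :=
  MvPolynomial.restrictTotalDegree (Fin d) ℝ m

/-- Vector-valued polynomials in `d` variables of total degree at most `m`. -/
def vecPoly (d m : ℕ) : Submodule ℝ (Fin d → MvPolynomial (Fin d) ℝ) :=
  Submodule.pi Set.univ fun _ => scalarPoly d m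

/-- The local velocity and pressure spaces on the elements of a triangulation, with
`P_1^d ⊆ P_V(K) ⊆ P_{iStar}^d` and `P_0 ⊆ P_Q(K) ⊆ P_{jStar}`, where `iStar ≥ jStar ≥ 0`. -/
structure LocalSpaces {Ω : Set (Vec d)} (T : Triangulation Ω) where
  iStar : ℕ
  jStar : ℕ
  jStar_le : jStar ≤ iStar
  PV : Finset (Vec d) → Submodule ℝ (Fin d → MvPolynomial (Fin d) ℝ)
  PQ : Finset (Vec d) → Submodule ℝ (MvPolynomial (Fin d) ℝ)
  le_PV : ∀ K ∈ T.elems, vecPoly d 1 ≤ PV K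
  PV_le : ∀ K ∈ T.elems, PV K ≤ vecPoly d iStar
  le_PQ : ∀ K ∈ T.elems, scalarPoly d 0 ≤ PQ K
  PQ_le : ∀ K ∈ T.elems, PQ K ≤ scalarPoly d jStar

/-- The velocity space `V(T)` of all `V ∈ W_0^{1,2}(Ω)^d` with `V|_K ∈ P_V(K)` for all `K ∈ T`. -/
def velocitySpace {Ω : Set (Vec d)} {T : Triangulation Ω} (S : LocalSpaces T) :
    Submodule ℝ (SobolevPair Ω) where
  carrier := {V | V ∈ W012 Ω ∧ ∀ K ∈ T.elems, ∃ p ∈ S.PV K, ∀ᵐ x ∂(volume.restrict Ω),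
    x ∈ convexHull ℝ (K : Set (Vec d)) → ∀ i, V.1 x i = MvPolynomial.eval (fun k => x k) (p i)}
  zero_mem' := by
    refine ⟨(W012 Ω).zero_mem, fun K _ => ⟨0, (S.PV K).zero_mem, ?_⟩⟩
    filter_upwards [Lp.coeFn_zero (Vec d) 2 (volume.restrict Ω)] with x hx _ i
    rw [Prod.fst_zero, hx]
    simp
  add_mem' := by
    rintro v w ⟨hv, hv'⟩ ⟨hw, hw'⟩
    refine ⟨(W012 Ω).add_mem hv hw, fun K hK => ?_⟩
    obtain ⟨p, hp, h1⟩ := hv' K hK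
    obtain ⟨q, hq, h2⟩ := hw' K hK
    refine ⟨p + q, (S.PV K).add_mem hp hq, ?_⟩
    filter_upwards [h1, h2, Lp.coeFn_add v.1 w.1] with x a b c hx i
    rw [Prod.fst_add, c]
    simp [a hx i, b hx i]
  smul_mem' := by
    rintro a v ⟨hv, hv'⟩
    refine ⟨(W012 Ω).smul_mem a hv, fun K hK => ?_⟩
    obtain ⟨p, hp, h1⟩ := hv' K hK
    refine ⟨a • p, (S.PV K).smul_mem a hp, ?_⟩
    filter_upwards [h1, Lp.coeFn_smul a v.1] with x b c hx i
    simp [c, b hx i, MvPolynomial.smul_eval]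

/-- `L^∞(Ω)`. -/
abbrev LInf (Ω : Set (Vec d)) : Type := Lp ℝ ∞ (volume.restrict Ω)

/-- The pressure space `Q(T)` of all `Q ∈ L^∞(Ω)` with `Q|_K ∈ P_Q(K)` for all `K ∈ T`. -/
def pressureSpace {Ω : Set (Vec d)} {T : Triangulation Ω} (S : LocalSpaces T) :
    Set (LInf Ω) :=
  {Q | ∀ K ∈ T.elems, ∃ p ∈ S.PQ K, ∀ᵐ x ∂(volume.restrict Ω),
    x ∈ convexHull ℝ (K : Set (Vec d)) → Q x = MvPolynomial.eval (fun k => x k) p}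

/-- The space `Q_0(T)` of discrete pressures with zero integral over `Ω`. -/
def pressureSpace₀ {Ω : Set (Vec d)} {T : Triangulation Ω} (S : LocalSpaces T) :
    Set (LInf Ω) :=
  {Q | Q ∈ pressureSpace S ∧ ∫ x in Ω, Q x = 0}

/-- The space `V_0(T)` of discretely divergence-free velocity vectors. -/
def velocitySpace₀ {Ω : Set (Vec d)} {T : Triangulation Ω} (S : LocalSpaces T) :
    Set (SobolevPair Ω) :=
  {V | V ∈ velocitySpace S ∧ ∀ Q ∈ pressureSpace S, ∫ x in Ω, Q x * divergence V x = 0}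

/-! ### The regularised Bingham problem without convection and the Kačanov iteration -/

/-- `μ_n(t) = σ / √(t + n⁻²) + 2 ν`. -/
def viscosity (σ ν : ℝ) (n : ℕ) (t : ℝ) : ℝ := σ / √(t + ((n : ℝ) ^ 2)⁻¹) + 2 * ν

/-- `a_n(U; V, W) = ∫_Ω (σ / |D U|_n + 2 ν) D V : D W`, where `|κ|_n = √(|κ|² + n⁻²)`. -/
def formA {Ω : Set (Vec d)} (σ ν : ℝ) (n : ℕ) (U V W : SobolevPair Ω) : ℝ :=
  ∫ x in Ω, (σ / √(‖symGrad U x‖ ^ 2 + ((n : ℝ) ^ 2)⁻¹) + 2 * ν) *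
    inner ℝ (symGrad V x) (symGrad W x)

/-- `b(Q, V) = - ∫_Ω Q div V`. -/
def formB {Ω : Set (Vec d)} (Q : LInf Ω) (V : SobolevPair Ω) : ℝ :=
  - ∫ x in Ω, Q x * divergence V x

/-- The load `∫_Ω f · V`. -/
def load {Ω : Set (Vec d)} (f : L2Vec Ω) (V : SobolevPair Ω) : ℝ :=
  ∫ x in Ω, inner ℝ (f x) (V.1 x)

/-- `(U, P) ∈ V(T) × Q_0(T)` solves the convection-free regularised discrete Bingham problem. -/
def IsDiscreteSolution {Ω : Set (Vec d)} {T : Triangulation Ω} (S : LocalSpaces T)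
    (σ ν : ℝ) (n : ℕ) (f : L2Vec Ω) (U : SobolevPair Ω) (P : LInf Ω) : Prop :=
  U ∈ velocitySpace S ∧ P ∈ pressureSpace₀ S ∧
    ∀ V ∈ velocitySpace S, ∀ Q ∈ pressureSpace S,
      formA σ ν n U U V + formB P V + formB Q U = load f V

/-- One step of the Kačanov iteration: `(U', P') ∈ V(T) × Q_0(T)` solves the linear problem in
which the viscosity is frozen at `U`. -/
def IsKacanovStep {Ω : Set (Vec d)} {T : Triangulation Ω} (S : LocalSpaces T)
    (σ ν : ℝ) (n : ℕ) (f : L2Vec Ω) (U U' : SobolevPair Ω) (P' : LInf Ω) : Prop :=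
  U' ∈ velocitySpace S ∧ P' ∈ pressureSpace₀ S ∧
    ∀ V ∈ velocitySpace S, ∀ Q ∈ pressureSpace S,
      formA σ ν n U U' V + formB P' V + formB Q U' = load f V

/-- `φ_n(s) = (1/2) ∫_0^s μ_n(t) dt`. -/
def potential (σ ν : ℝ) (n : ℕ) (s : ℝ) : ℝ :=
  (1 / 2) * ∫ t in (0 : ℝ)..s, viscosity σ ν n t

/-- The energy `H_n(U) = ∫_Ω φ_n(|D U|²) - ∫_Ω f · U`. -/
def energy {Ω : Set (Vec d)} (σ ν : ℝ) (n : ℕ) (f : L2Vec Ω) (U : SobolevPair Ω) : ℝ :=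
  (∫ x in Ω, potential σ ν n (‖symGrad U x‖ ^ 2)) - load f U

/-- The contraction factor `q_con`. -/
def qCon (σ ν : ℝ) (n : ℕ) : ℝ :=
  1 - ν ^ 3 / ((√3 * σ * n + 2 * ν) * (σ * n + 2 * ν) ^ 2)

end BinghamFE

end

open MeasureTheory
open scoped ENNReal ContDiff

namespace BinghamFE

variable {d : ℕ}

/-! ### Pointwise inequalities for the regularised Bingham viscosity -/

section Pointwise

variable {E : Type*} [NormedAddCommGroup E] [InnerProductSpace ℝ E]

/-! Write c = σn + 2ν, S(V) = ‖DV‖² in L², V ↦ V' for one Kačanov step, δ = V' - V and e = V - U. On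
discretely divergence-free fields the pressures drop out, so a(V; V', e) = load e = a(U; U, e).

Error bound: 2ν ≤ μ ≤ c, and the flux G ↦ μ(|G|²)G is strongly monotone with constant 2ν. Hence 2ν
S(e) ≤ a(V; V, e) - a(U; U, e) = a(V; V - V', e), and Young's inequality gives S(e) ≤ c²/(4ν²) S(δ)
(`strainSq_sub_solution_le`). Korn's inequality with constant 2 turns this into the bound on
gradients.

Energy: the potential is concave in |D|², so the quadratic energy with viscosity frozen at V bounds
increments of H from above (`energy_sub_le`). Based at V, this gives H(V) - H(V') ≥ ν S(δ); based at
U, H(V) - H(U) ≤ (c/2) S(e). Together, H(V) - H(V') ≥ (8ν³/c³)(H(V) - H(U)), which is stronger than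
the stated contraction. -/

theorem inner_add_le_sqrt_mul_sqrt {ε : ℝ} (hε : 0 < ε) (a b : E) :
    inner ℝ a b + ε ≤ √(‖a‖ ^ 2 + ε) * √(‖b‖ ^ 2 + ε) := by
  rw [← Real.sqrt_mul (by positivity)]
  apply Real.le_sqrt_of_sq_le
  have h := abs_real_inner_le_norm a b
  have h2 : inner ℝ a b ≤ ‖a‖ * ‖b‖ := (le_abs_self _).trans h
  have h3 : (inner ℝ a b) ^ 2 ≤ (‖a‖ * ‖b‖) ^ 2 := sq_le_sq.2 (h.trans (le_abs_self _))
  -- This is Cauchy–Schwarz for (a, √ε) and (b, √ε): the difference of squares is ‖a‖²‖b‖² - ⟨a, b⟩²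
  -- + ε‖a - b‖².
  nlinarith [sq_nonneg (‖a‖ - ‖b‖), norm_nonneg a, norm_nonneg b]

/-- Monotonicity of the gradient of the convex function a ↦ √(‖a‖² + ε). With s, t the two roots,
the numerator over the common denominator is (s + t)(st - ⟨a, b⟩ - ε). -/
theorem inner_div_sqrt_monotone {ε : ℝ} (hε : 0 < ε) (a b : E) :
    0 ≤ inner ℝ a (a - b) / √(‖a‖ ^ 2 + ε) - inner ℝ b (a - b) / √(‖b‖ ^ 2 + ε) := by
  have hs : 0 < √(‖a‖ ^ 2 + ε) := Real.sqrt_pos.2 (by positivity)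
  have ht : 0 < √(‖b‖ ^ 2 + ε) := Real.sqrt_pos.2 (by positivity)
  have h := inner_add_le_sqrt_mul_sqrt hε a b
  have ha : ‖a‖ ^ 2 = √(‖a‖ ^ 2 + ε) ^ 2 - ε := by rw [Real.sq_sqrt (by positivity)]; ring
  have hb : ‖b‖ ^ 2 = √(‖b‖ ^ 2 + ε) ^ 2 - ε := by rw [Real.sq_sqrt (by positivity)]; ring
  rw [inner_sub_right, inner_sub_right, real_inner_self_eq_norm_sq, real_inner_self_eq_norm_sq,
    real_inner_comm a b]
  generalize √(‖a‖ ^ 2 + ε) = s at *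
  generalize √(‖b‖ ^ 2 + ε) = t at *
  rw [ha, hb, div_sub_div _ _ hs.ne' ht.ne']
  apply div_nonneg _ (by positivity)
  have : (s ^ 2 - ε - inner ℝ a b) * t - s * (inner ℝ a b - (t ^ 2 - ε))
      = (s + t) * (s * t - (inner ℝ a b + ε)) := by ring
  nlinarith [mul_nonneg (add_pos hs ht).le (sub_nonneg.2 h)]

/-- The Newtonian part 2ν of the viscosity contributes the left side exactly; the plastic part is
monotone and can be discarded. -/
theorem two_mul_sq_norm_sub_le_viscosity {σ ν : ℝ} (hσ : 0 ≤ σ) {n : ℕ} (hn : 1 ≤ n) (a b : E) :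
    2 * ν * ‖a - b‖ ^ 2 ≤ viscosity σ ν n (‖a‖ ^ 2) * inner ℝ a (a - b) -
      viscosity σ ν n (‖b‖ ^ 2) * inner ℝ b (a - b) := by
  have hε : 0 < ((n : ℝ) ^ 2)⁻¹ := by positivity
  have h := mul_nonneg hσ (inner_div_sqrt_monotone hε a b)
  have h2 : ‖a - b‖ ^ 2 = inner ℝ a (a - b) - inner ℝ b (a - b) := by
    rw [← inner_sub_left, real_inner_self_eq_norm_sq]
  unfold viscosity
  rw [h2]
  calc _ ≤ σ * (inner ℝ a (a - b) / √(‖a‖ ^ 2 + ((n : ℝ) ^ 2)⁻¹) -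
        inner ℝ b (a - b) / √(‖b‖ ^ 2 + ((n : ℝ) ^ 2)⁻¹)) +
        2 * ν * (inner ℝ a (a - b) - inner ℝ b (a - b)) := by linarith
    _ = _ := by ring

end Pointwise

/-! ### Scalar bounds on the viscosity and its potential -/

theorem continuousOn_viscosity (σ ν : ℝ) {n : ℕ} (hn : 1 ≤ n) :
    ContinuousOn (viscosity σ ν n) (Set.Ici 0) := by
  have hε : 0 < ((n : ℝ) ^ 2)⁻¹ := by positivity
  unfold viscosity
  refine ContinuousOn.add (ContinuousOn.div continuousOn_const ?_ ?_) continuousOn_const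
  · exact (Real.continuous_sqrt.comp (by fun_prop)).continuousOn
  · intro t ht
    have : (0 : ℝ) ≤ t := ht
    exact (Real.sqrt_pos.2 (by positivity)).ne'

theorem two_mul_le_viscosity {σ : ℝ} (hσ : 0 ≤ σ) (ν : ℝ) (n : ℕ) (t : ℝ) :
    2 * ν ≤ viscosity σ ν n t := by
  unfold viscosity
  have : 0 ≤ σ / √(t + ((n : ℝ) ^ 2)⁻¹) := by positivity
  linarith

theorem viscosity_le {σ : ℝ} (hσ : 0 ≤ σ) (ν : ℝ) {n : ℕ} (hn : 1 ≤ n) {t : ℝ} (ht : 0 ≤ t) :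
    viscosity σ ν n t ≤ σ * n + 2 * ν := by
  unfold viscosity
  have hn' : (0 : ℝ) < n := by exact_mod_cast hn
  have h : (n : ℝ)⁻¹ ≤ √(t + ((n : ℝ) ^ 2)⁻¹) := by
    apply Real.le_sqrt_of_sq_le
    rw [inv_pow]
    linarith
  have : σ / √(t + ((n : ℝ) ^ 2)⁻¹) ≤ σ / (n : ℝ)⁻¹ :=
    div_le_div_of_nonneg_left hσ (by positivity) h
  rw [div_inv_eq_mul] at this
  linarith

theorem potential_eq (σ ν : ℝ) {n : ℕ} (hn : 1 ≤ n) {s : ℝ} (hs : 0 ≤ s) :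
    potential σ ν n s =
      σ * (√(s + ((n : ℝ) ^ 2)⁻¹) - √(((n : ℝ) ^ 2)⁻¹)) + ν * s := by
  have hε : 0 < ((n : ℝ) ^ 2)⁻¹ := by positivity
  have hsub : Set.uIcc 0 s ⊆ Set.Ici 0 := by
    rw [Set.uIcc_of_le hs]
    exact Set.Icc_subset_Ici_self
  have h : ∫ t in (0 : ℝ)..s, viscosity σ ν n t =
      (2 * σ * √(s + ((n : ℝ) ^ 2)⁻¹) + 2 * ν * s) -
        (2 * σ * √(0 + ((n : ℝ) ^ 2)⁻¹) + 2 * ν * 0) := by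
    refine intervalIntegral.integral_eq_sub_of_hasDerivAt
      (f := fun t => 2 * σ * √(t + ((n : ℝ) ^ 2)⁻¹) + 2 * ν * t) ?_
      ((continuousOn_viscosity σ ν hn).mono hsub).intervalIntegrable
    intro t ht
    have ht0 : 0 ≤ t := hsub ht
    have h1 : HasDerivAt (fun t => t + ((n : ℝ) ^ 2)⁻¹) 1 t := (hasDerivAt_id t).add_const _
    have h2 := ((h1.sqrt (by positivity)).const_mul (2 * σ)).add
      ((hasDerivAt_id t).const_mul (2 * ν))
    refine h2.congr_deriv ?_
    unfold viscosity
    have : √(t + ((n : ℝ) ^ 2)⁻¹) ≠ 0 := (Real.sqrt_pos.2 (by positivity)).ne'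
    field_simp
  rw [potential, h, zero_add]
  ring

/-- Concavity: the graph lies below its tangent at t, because the viscosity is nonincreasing. For
the square-root part this reduces to (a - b)² ≥ 0 with a, b the two roots. -/
theorem potential_sub_le {σ : ℝ} (hσ : 0 ≤ σ) (ν : ℝ) {n : ℕ} (hn : 1 ≤ n) {s t : ℝ}
    (hs : 0 ≤ s) (ht : 0 ≤ t) :
    potential σ ν n s - potential σ ν n t ≤ 1 / 2 * (viscosity σ ν n t * (s - t)) := by
  have hε : 0 < ((n : ℝ) ^ 2)⁻¹ := by positivity
  rw [potential_eq σ ν hn hs, potential_eq σ ν hn ht, viscosity]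
  have hst : s - t = √(s + ((n : ℝ) ^ 2)⁻¹) ^ 2 - √(t + ((n : ℝ) ^ 2)⁻¹) ^ 2 := by
    rw [Real.sq_sqrt (by positivity), Real.sq_sqrt (by positivity)]
    ring
  have hb : 0 < √(t + ((n : ℝ) ^ 2)⁻¹) := Real.sqrt_pos.2 (by positivity)
  have key : √(s + ((n : ℝ) ^ 2)⁻¹) - √(t + ((n : ℝ) ^ 2)⁻¹) ≤
      1 / 2 * ((s - t) / √(t + ((n : ℝ) ^ 2)⁻¹)) := by
    rw [hst]
    generalize √(s + ((n : ℝ) ^ 2)⁻¹) = a at *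
    generalize √(t + ((n : ℝ) ^ 2)⁻¹) = b at *
    rw [← mul_div_assoc, le_div_iff₀ hb]
    nlinarith [sq_nonneg (a - b)]
  have := mul_le_mul_of_nonneg_left key hσ
  calc _ = σ * (√(s + ((n : ℝ) ^ 2)⁻¹) - √(t + ((n : ℝ) ^ 2)⁻¹)) + ν * (s - t) := by ring
    _ ≤ σ * (1 / 2 * ((s - t) / √(t + ((n : ℝ) ^ 2)⁻¹))) + ν * (s - t) := by linarith
    _ = _ := by ring

/-! ### Korn's inequality on `W_0^{1,2}` -/

theorem IsTestFunction.partialDeriv {Ω : Set (Vec d)} {u : Vec d → ℝ} (hu : IsTestFunction Ω u)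
    (j : Fin d) : IsTestFunction Ω (partialDeriv j u) := by
  refine ⟨?_, hu.hasCompactSupport_partialDeriv j, ?_⟩
  · exact (hu.smooth.fderiv_right (m := ∞) (by simp)).clm_apply contDiff_const
  · exact (tsupport_fderiv_apply_subset ℝ _).trans hu.support

theorem IsTestFunction.integrable_mul {Ω : Set (Vec d)} {u v : Vec d → ℝ}
    (hu : IsTestFunction Ω u) (hv : IsTestFunction Ω v) : Integrable (fun x => u x * v x) :=
  (hu.smooth.continuous.mul hv.smooth.continuous).integrable_of_hasCompactSupport
    hu.compact.mul_right

theorem partialDeriv_comm {Ω : Set (Vec d)} {u : Vec d → ℝ} (hu : IsTestFunction Ω u)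
    (i j : Fin d) (x : Vec d) :
    partialDeriv i (partialDeriv j u) x = partialDeriv j (partialDeriv i u) x := by
  have hd : DifferentiableAt ℝ (fderiv ℝ u) x :=
    (hu.smooth.fderiv_right (m := ∞) (by simp)).differentiable (by simp) x
  have h (i j : Fin d) : partialDeriv i (partialDeriv j u) x =
      fderiv ℝ (fderiv ℝ u) x (EuclideanSpace.single i 1) (EuclideanSpace.single j 1) := by
    change fderiv ℝ (fun y => fderiv ℝ u y (EuclideanSpace.single j 1)) x _ = _
    rw [fderiv_clm_apply hd (differentiableAt_const _)]
    simp
  rw [h, h]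
  exact (hu.smooth.contDiffAt.isSymmSndFDerivAt
    (by simpa using ENat.LEInfty.out)).eq _ _

theorem integral_mul_partialDeriv {Ω : Set (Vec d)} {u v : Vec d → ℝ}
    (hu : IsTestFunction Ω u) (hv : IsTestFunction Ω v) (j : Fin d) :
    ∫ x, u x * partialDeriv j v x = - ∫ x, partialDeriv j u x * v x :=
  integral_mul_fderiv_eq_neg_fderiv_mul_of_integrable
    ((hu.partialDeriv j).integrable_mul hv) (hu.integrable_mul (hv.partialDeriv j))
    (hu.integrable_mul hv) (fun x _ => hu.smooth.differentiable (by simp) x)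
    (fun x _ => hv.smooth.differentiable (by simp) x)

/-- Integrating by parts twice moves both derivatives across, and the mixed second derivatives
commute. -/
theorem integral_partialDeriv_mul_partialDeriv_comm {Ω : Set (Vec d)} {u v : Vec d → ℝ}
    (hu : IsTestFunction Ω u) (hv : IsTestFunction Ω v) (i j : Fin d) :
    ∫ x, partialDeriv j u x * partialDeriv i v x =
      ∫ x, partialDeriv i u x * partialDeriv j v x := by
  have h1 := integral_mul_partialDeriv hu (hv.partialDeriv i) j
  have h2 := integral_mul_partialDeriv hu (hv.partialDeriv j) i
  simp_rw [partialDeriv_comm hv j i] at h1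
  linarith

theorem two_mul_norm_symPart_sq (G : Mat d) :
    2 * ‖symPart G‖ ^ 2 = ‖G‖ ^ 2 + ∑ i, ∑ j, G (i, j) * G (j, i) := by
  simp only [EuclideanSpace.norm_sq_eq, Real.norm_eq_abs, sq_abs, Fintype.sum_prod_type, symPart]
  have h : ∑ i, ∑ j, G (i, j) ^ 2 = ∑ i, ∑ j, G (j, i) ^ 2 := Finset.sum_comm
  have h2 : 2 * ∑ i, ∑ j, (1 / 2 * (G (i, j) + G (j, i))) ^ 2 =
      1 / 2 * ∑ i, ∑ j, G (i, j) ^ 2 + 1 / 2 * ∑ i, ∑ j, G (j, i) ^ 2 +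
        ∑ i, ∑ j, G (i, j) * G (j, i) := by
    simp only [Finset.mul_sum, ← Finset.sum_add_distrib]
    refine Finset.sum_congr rfl fun i _ => Finset.sum_congr rfl fun j _ => ?_
    ring
  rw [h2, ← h]
  ring

theorem norm_symPart_le (G : Mat d) : ‖symPart G‖ ≤ ‖G‖ := by
  have h := two_mul_norm_symPart_sq G
  have h2 : ∑ i, ∑ j, G (i, j) * G (j, i) ≤ ‖G‖ ^ 2 := by
    simp only [EuclideanSpace.norm_sq_eq, Real.norm_eq_abs, sq_abs, Fintype.sum_prod_type]
    have h : ∑ i, ∑ j, G (i, j) ^ 2 = ∑ i, ∑ j, G (j, i) ^ 2 := Finset.sum_comm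
    have h2 : ∑ i, ∑ j, G (i, j) * G (j, i) ≤
        1 / 2 * ∑ i, ∑ j, G (i, j) ^ 2 + 1 / 2 * ∑ i, ∑ j, G (j, i) ^ 2 := by
      simp only [Finset.mul_sum, ← Finset.sum_add_distrib]
      refine Finset.sum_le_sum fun i _ => Finset.sum_le_sum fun j _ => ?_
      nlinarith [sq_nonneg (G (i, j) - G (j, i))]
    linarith
  nlinarith [norm_nonneg G, norm_nonneg (symPart G)]

/-- The symmetric part as a continuous linear map. -/
noncomputable def symPartL (d : ℕ) : Mat d →L[ℝ] Mat d :=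
  LinearMap.mkContinuous
    { toFun := symPart
      map_add' := fun G H => by ext ij; simp [symPart]; ring
      map_smul' := fun c G => by ext ij; simp [symPart]; ring }
    1 fun G => by simpa using norm_symPart_le G

theorem IsTestFunction.coord {Ω : Set (Vec d)} {φ : Vec d → Vec d} (hφ : IsTestFunction Ω φ)
    (i : Fin d) : IsTestFunction Ω fun x => φ x i := by
  refine ⟨(EuclideanSpace.proj i : Vec d →L[ℝ] ℝ).contDiff.comp hφ.smooth,
    hφ.compact.mono ?_, (closure_mono ?_).trans hφ.support⟩ <;>
  · intro x hx h
    exact hx (by simp [h])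

theorem classicalGrad_apply {Ω : Set (Vec d)} {φ : Vec d → Vec d} (hφ : IsTestFunction Ω φ)
    (x : Vec d) (i j : Fin d) :
    classicalGrad φ x (i, j) = partialDeriv j (fun y => φ y i) x := by
  have h := ((EuclideanSpace.proj i : Vec d →L[ℝ] ℝ).hasFDerivAt.comp x
    (hφ.smooth.differentiable (by simp) x).hasFDerivAt).fderiv
  change _ = fderiv ℝ ((EuclideanSpace.proj i : Vec d →L[ℝ] ℝ) ∘ φ) x _
  rw [h]
  rfl

/-- Exchanging the derivatives in each term turns the integral of tr((∇φ)²) into that of (div φ)².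
-/
theorem integral_trace_classicalGrad_sq_nonneg {Ω : Set (Vec d)} {φ : Vec d → Vec d}
    (hφ : IsTestFunction Ω φ) :
    0 ≤ ∫ x, ∑ i, ∑ j, classicalGrad φ x (i, j) * classicalGrad φ x (j, i) := by
  have hI (p q : Fin d × Fin d) : Integrable fun x =>
      classicalGrad φ x p * classicalGrad φ x q := by
    obtain ⟨i, j⟩ := p
    obtain ⟨k, l⟩ := q
    simp only [classicalGrad_apply hφ]
    exact ((hφ.coord i).partialDeriv j).integrable_mul ((hφ.coord k).partialDeriv l)
  -- The index maps are left free so that the same interchange of sum and integral serves both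
  -- tr((∇φ)²) and (div φ)².
  have hS (p q : Fin d → Fin d → Fin d × Fin d) :
      ∫ x, ∑ i, ∑ j, classicalGrad φ x (p i j) * classicalGrad φ x (q i j) =
        ∑ i, ∑ j, ∫ x, classicalGrad φ x (p i j) * classicalGrad φ x (q i j) := by
    rw [integral_finsetSum _ fun i _ => integrable_finsetSum _ fun j _ => hI (p i j) (q i j)]
    exact Finset.sum_congr rfl fun i _ => integral_finsetSum _ fun j _ => hI _ _
  have h : ∫ x, ∑ i, ∑ j, classicalGrad φ x (i, j) * classicalGrad φ x (j, i) =
      ∫ x, (∑ i, classicalGrad φ x (i, i)) ^ 2 := by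
    simp_rw [sq, Finset.sum_mul_sum]
    refine (hS (fun i j => (i, j)) fun i j => (j, i)).trans
      (Eq.trans ?_ (hS (fun i _ => (i, i)) fun _ j => (j, j)).symm)
    refine Finset.sum_congr rfl fun i _ => Finset.sum_congr rfl fun j _ => ?_
    simp only [classicalGrad_apply hφ]
    exact integral_partialDeriv_mul_partialDeriv_comm (hφ.coord i) (hφ.coord j) i j
  rw [h]
  exact integral_nonneg fun x => sq_nonneg _

theorem L2_norm_sq_eq_integral {F : Type*} [NormedAddCommGroup F] [InnerProductSpace ℝ F]
    {μ : Measure (Vec d)} (G : Lp F 2 μ) : ‖G‖ ^ 2 = ∫ x, ‖G x‖ ^ 2 ∂μ := by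
  rw [← real_inner_self_eq_norm_sq, L2.inner_def]
  simp only [real_inner_self_eq_norm_sq]

/-- The squared `L²` norm of the symmetric gradient. -/
noncomputable def strainSq {Ω : Set (Vec d)} (V : SobolevPair Ω) : ℝ := ∫ x in Ω, ‖symGrad V x‖ ^ 2

/-- Being the squared norm of a bounded linear image of ∇V, the strain is continuous in V, which
lets Korn's inequality pass to the closure. -/
theorem strainSq_eq {Ω : Set (Vec d)} (V : SobolevPair Ω) :
    strainSq V = ‖(symPartL d).compLpL 2 (volume.restrict Ω) V.2‖ ^ 2 := by
  rw [L2_norm_sq_eq_integral]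
  refine integral_congr_ae ?_
  filter_upwards [(symPartL d).coeFn_compLpL (p := 2) (μ := volume.restrict Ω) V.2] with x hx
  rw [hx]
  rfl

theorem strainSq_nonneg {Ω : Set (Vec d)} (V : SobolevPair Ω) : 0 ≤ strainSq V :=
  integral_nonneg fun _ => sq_nonneg _

theorem memLp_symGrad {Ω : Set (Vec d)} (V : SobolevPair Ω) :
    MemLp (symGrad V) 2 (volume.restrict Ω) :=
  (symPartL d).comp_memLp' (Lp.memLp V.2)

theorem integrable_norm_sq_symGrad {Ω : Set (Vec d)} (V : SobolevPair Ω) :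
    Integrable (fun x => ‖symGrad V x‖ ^ 2) (volume.restrict Ω) :=
  (memLp_two_iff_integrable_sq_norm (memLp_symGrad V).1).1 (memLp_symGrad V)

theorem norm12_nonneg {Ω : Set (Vec d)} (V : SobolevPair Ω) : 0 ≤ norm12 V := norm_nonneg _

theorem strainSq_le {Ω : Set (Vec d)} (V : SobolevPair Ω) : strainSq V ≤ norm12 V ^ 2 := by
  rw [norm12, L2_norm_sq_eq_integral]
  refine integral_mono (integrable_norm_sq_symGrad V)
    ((memLp_two_iff_integrable_sq_norm (Lp.memLp V.2).1).1 (Lp.memLp V.2)) fun x => ?_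
  exact pow_le_pow_left₀ (norm_nonneg _) (norm_symPart_le _) 2

/-- Since 2|sym G|² = |G|² + tr(G²), the gap between the two sides is the integral of tr((∇φ)²),
which is nonnegative. -/
theorem korn_testPairs {Ω : Set (Vec d)} {V : SobolevPair Ω} (hV : V ∈ testPairs Ω) :
    norm12 V ^ 2 ≤ 2 * strainSq V := by
  obtain ⟨φ, hφ, -, h2⟩ := hV
  have hI2 := (memLp_two_iff_integrable_sq_norm (Lp.memLp V.2).1).1 (Lp.memLp V.2)
  have hIs := integrable_norm_sq_symGrad V
  -- The gradient of φ vanishes off Ω, so the whole-space integration by parts applies.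
  have hΩ : ∫ x in Ω, ∑ i, ∑ j, classicalGrad φ x (i, j) * classicalGrad φ x (j, i) =
      ∫ x, ∑ i, ∑ j, classicalGrad φ x (i, j) * classicalGrad φ x (j, i) := by
    refine setIntegral_eq_integral_of_forall_compl_eq_zero fun x hx => ?_
    have : fderiv ℝ φ x = 0 :=
      image_eq_zero_of_notMem_tsupport
        fun h => hx (hφ.support (tsupport_fderiv_subset ℝ h))
    simp [classicalGrad, this]
  have h : 2 * strainSq V - norm12 V ^ 2 =
      ∫ x in Ω, ∑ i, ∑ j, classicalGrad φ x (i, j) * classicalGrad φ x (j, i) := by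
    rw [norm12, L2_norm_sq_eq_integral, strainSq, ← integral_const_mul,
      ← integral_sub (hIs.const_mul 2) hI2]
    refine integral_congr_ae ?_
    filter_upwards [h2] with x hx
    rw [symGrad, two_mul_norm_symPart_sq, hx]
    ring
  have := integral_trace_classicalGrad_sq_nonneg hφ
  linarith

/-- Korn's inequality on `W_0^{1,2}(Ω)^d`. -/
theorem korn {Ω : Set (Vec d)} {V : SobolevPair Ω} (hV : V ∈ W012 Ω) :
    norm12 V ^ 2 ≤ 2 * strainSq V := by
  have hc : IsClosed {W : SobolevPair Ω | norm12 W ^ 2 ≤ 2 * strainSq W} := by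
    simp only [strainSq_eq, norm12]
    refine isClosed_le (by fun_prop) ?_
    exact continuous_const.mul
      ((((symPartL d).compLpL 2 (volume.restrict Ω)).continuous.comp continuous_snd).norm.pow 2)
  exact closure_minimal (fun W hW => korn_testPairs hW) hc hV.2

/-! ### The forms and the energy -/

section Forms

variable {Ω : Set (Vec d)}

theorem symGrad_sub (V W : SobolevPair Ω) :
    ∀ᵐ x ∂volume.restrict Ω, symGrad (V - W) x = symGrad V x - symGrad W x := by
  filter_upwards [Lp.coeFn_sub V.2 W.2] with x hx
  rw [symGrad, Prod.snd_sub, hx, Pi.sub_apply]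
  exact map_sub (symPartL d) _ _

theorem symGrad_zero : ∀ᵐ x ∂volume.restrict Ω, symGrad (0 : SobolevPair Ω) x = 0 := by
  filter_upwards [Lp.coeFn_zero (Mat d) 2 (volume.restrict Ω)] with x hx
  rw [symGrad, Prod.snd_zero, hx]
  exact map_zero (symPartL d)

theorem formA_eq (σ ν : ℝ) (n : ℕ) (U V W : SobolevPair Ω) :
    formA σ ν n U V W =
      ∫ x in Ω, viscosity σ ν n (‖symGrad U x‖ ^ 2) * inner ℝ (symGrad V x) (symGrad W x) := rfl

theorem integrable_viscosity_mul {σ ν : ℝ} (hσ : 0 ≤ σ) (hν : 0 < ν) {n : ℕ} (hn : 1 ≤ n)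
    (U : SobolevPair Ω) {g : Vec d → ℝ} (hg : Integrable g (volume.restrict Ω)) :
    Integrable (fun x => viscosity σ ν n (‖symGrad U x‖ ^ 2) * g x) (volume.restrict Ω) := by
  refine hg.bdd_mul (c := σ * n + 2 * ν) ?_ (Filter.Eventually.of_forall fun x => ?_)
  · have hc : Continuous fun G : Mat d => viscosity σ ν n (‖G‖ ^ 2) :=
      (continuousOn_viscosity σ ν hn).comp_continuous (by fun_prop) fun G => sq_nonneg ‖G‖
    exact hc.comp_aestronglyMeasurable (memLp_symGrad U).1
  · have h1 := two_mul_le_viscosity hσ ν n (‖symGrad U x‖ ^ 2)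
    rw [Real.norm_of_nonneg (by linarith)]
    exact viscosity_le hσ ν hn (sq_nonneg _)

theorem integrable_inner_of_memLp_two {F : Type*} [NormedAddCommGroup F] [InnerProductSpace ℝ F]
    {μ : Measure (Vec d)} {g h : Vec d → F} (hg : MemLp g 2 μ) (hh : MemLp h 2 μ) :
    Integrable (fun x => inner ℝ (g x) (h x)) μ := by
  refine (L2.integrable_inner (𝕜 := ℝ) (hg.toLp g) (hh.toLp h)).congr ?_
  filter_upwards [hg.coeFn_toLp, hh.coeFn_toLp] with x a b
  rw [a, b]

theorem integrable_formA {σ ν : ℝ} (hσ : 0 ≤ σ) (hν : 0 < ν) {n : ℕ} (hn : 1 ≤ n)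
    (U V W : SobolevPair Ω) :
    Integrable (fun x => viscosity σ ν n (‖symGrad U x‖ ^ 2) *
      inner ℝ (symGrad V x) (symGrad W x)) (volume.restrict Ω) :=
  integrable_viscosity_mul hσ hν hn U
    (integrable_inner_of_memLp_two (memLp_symGrad V) (memLp_symGrad W))

theorem formA_sub_middle {σ ν : ℝ} (hσ : 0 ≤ σ) (hν : 0 < ν) {n : ℕ} (hn : 1 ≤ n)
    (U V V' W : SobolevPair Ω) :
    formA σ ν n U (V - V') W = formA σ ν n U V W - formA σ ν n U V' W := by
  simp only [formA_eq]
  rw [← integral_sub (integrable_formA hσ hν hn U V W) (integrable_formA hσ hν hn U V' W)]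
  refine integral_congr_ae ?_
  filter_upwards [symGrad_sub V V'] with x hx
  rw [hx, inner_sub_left]
  ring

theorem formA_zero_right (σ ν : ℝ) (n : ℕ) (U V : SobolevPair Ω) : formA σ ν n U V 0 = 0 := by
  rw [formA_eq, integral_eq_zero_of_ae]
  filter_upwards [symGrad_zero (Ω := Ω)] with x hx
  rw [hx]
  simp

theorem load_zero (f : L2Vec Ω) : load f 0 = 0 := by
  rw [load, integral_eq_zero_of_ae]
  filter_upwards [Lp.coeFn_zero (Vec d) 2 (volume.restrict Ω)] with x hx
  rw [Prod.fst_zero, hx]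
  simp

theorem load_sub (f : L2Vec Ω) (V W : SobolevPair Ω) : load f (V - W) = load f V - load f W := by
  simp only [load]
  rw [← integral_sub (L2.integrable_inner _ _) (L2.integrable_inner _ _)]
  refine integral_congr_ae ?_
  filter_upwards [Lp.coeFn_sub V.1 W.1] with x hx
  rw [Prod.fst_sub, hx, Pi.sub_apply, inner_sub_right]

theorem divergence_zero : ∀ᵐ x ∂volume.restrict Ω, divergence (0 : SobolevPair Ω) x = 0 := by
  filter_upwards [Lp.coeFn_zero (Mat d) 2 (volume.restrict Ω)] with x hx
  rw [divergence, Prod.snd_zero, hx]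
  simp

theorem formB_zero_right (Q : LInf Ω) : formB Q (0 : SobolevPair Ω) = 0 := by
  rw [formB, integral_eq_zero_of_ae, neg_zero]
  filter_upwards [divergence_zero (Ω := Ω)] with x hx
  rw [hx]
  simp

theorem formB_zero_left (V : SobolevPair Ω) : formB (0 : LInf Ω) V = 0 := by
  rw [formB, integral_eq_zero_of_ae, neg_zero]
  filter_upwards [Lp.coeFn_zero ℝ ∞ (volume.restrict Ω)] with x hx
  rw [hx]
  simp

theorem memLp_divergence (V : SobolevPair Ω) :
    MemLp (divergence V) 2 (volume.restrict Ω) :=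
  memLp_finsetSum _ fun i _ =>
    (EuclideanSpace.proj (i, i) : Mat d →L[ℝ] ℝ).comp_memLp' (Lp.memLp V.2)

theorem formB_sub_right (hΩb : Bornology.IsBounded Ω) (Q : LInf Ω) (V W : SobolevPair Ω) :
    formB Q (V - W) = formB Q V - formB Q W := by
  have : IsFiniteMeasure (volume.restrict Ω) :=
    isFiniteMeasure_restrict.2 hΩb.measure_lt_top.ne
  have hI (V : SobolevPair Ω) :
      Integrable (fun x => Q x * divergence V x) (volume.restrict Ω) :=
    -- Bounded Ω has finite measure, so div V ∈ L² is integrable and stays so after multiplication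
    -- by Q ∈ L^∞.
    ((memLp_divergence V).integrable (by norm_num)).mul_of_top_right (Lp.memLp Q)
  simp only [formB]
  have h : ∫ x in Ω, Q x * divergence (V - W) x =
      (∫ x in Ω, Q x * divergence V x) - ∫ x in Ω, Q x * divergence W x := by
    rw [← integral_sub (hI V) (hI W)]
    refine integral_congr_ae ?_
    filter_upwards [Lp.coeFn_sub V.2 W.2] with x hx
    simp only [divergence, Prod.snd_sub, hx, Pi.sub_apply, PiLp.sub_apply, Finset.sum_sub_distrib]
    ring
  rw [h]
  ring

theorem two_mul_strainSq_le_formA {σ ν : ℝ} (hσ : 0 ≤ σ) (hν : 0 < ν) {n : ℕ} (hn : 1 ≤ n)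
    (U V : SobolevPair Ω) : 2 * ν * strainSq V ≤ formA σ ν n U V V := by
  rw [strainSq, ← integral_const_mul, formA_eq]
  refine integral_mono ((integrable_norm_sq_symGrad V).const_mul _)
    (integrable_formA hσ hν hn U V V) fun x => ?_
  simp only [real_inner_self_eq_norm_sq]
  exact mul_le_mul_of_nonneg_right (two_mul_le_viscosity hσ ν n _) (sq_nonneg _)

theorem formA_self_le {σ ν : ℝ} (hσ : 0 ≤ σ) (hν : 0 < ν) {n : ℕ} (hn : 1 ≤ n)
    (U V : SobolevPair Ω) : formA σ ν n U V V ≤ (σ * n + 2 * ν) * strainSq V := by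
  rw [strainSq, ← integral_const_mul, formA_eq]
  refine integral_mono (integrable_formA hσ hν hn U V V)
    ((integrable_norm_sq_symGrad V).const_mul _) fun x => ?_
  simp only [real_inner_self_eq_norm_sq]
  exact mul_le_mul_of_nonneg_right (viscosity_le hσ ν hn (sq_nonneg _)) (sq_nonneg _)

/-- Boundedness of the frozen form, combined with Young's inequality. -/
theorem formA_le_young {σ ν : ℝ} (hσ : 0 ≤ σ) (hν : 0 < ν) {n : ℕ} (hn : 1 ≤ n)
    (U V W : SobolevPair Ω) :
    formA σ ν n U V W ≤ (σ * n + 2 * ν) ^ 2 / (4 * ν) * strainSq V + ν * strainSq W := by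
  rw [strainSq, strainSq, ← integral_const_mul, ← integral_const_mul,
    ← integral_add ((integrable_norm_sq_symGrad V).const_mul _)
      ((integrable_norm_sq_symGrad W).const_mul _), formA_eq]
  refine integral_mono (integrable_formA hσ hν hn U V W)
    (((integrable_norm_sq_symGrad V).const_mul _).add
      ((integrable_norm_sq_symGrad W).const_mul _)) fun x => ?_
  have h0 := two_mul_le_viscosity hσ ν n (‖symGrad U x‖ ^ 2)
  have h1 := viscosity_le hσ ν hn (sq_nonneg ‖symGrad U x‖)
  have h2 := real_inner_le_norm (symGrad V x) (symGrad W x)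
  -- The weight ν on W is half the monotonicity constant 2ν, so that this term can later be
  -- absorbed.
  have h3 : (σ * n + 2 * ν) * (‖symGrad V x‖ * ‖symGrad W x‖) ≤
      (σ * n + 2 * ν) ^ 2 / (4 * ν) * ‖symGrad V x‖ ^ 2 + ν * ‖symGrad W x‖ ^ 2 := by
    have : (σ * n + 2 * ν) ^ 2 / (4 * ν) * ‖symGrad V x‖ ^ 2 + ν * ‖symGrad W x‖ ^ 2 -
        (σ * n + 2 * ν) * (‖symGrad V x‖ * ‖symGrad W x‖) =
        ((σ * n + 2 * ν) * ‖symGrad V x‖ - 2 * ν * ‖symGrad W x‖) ^ 2 / (4 * ν) := by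
      field_simp
      ring
    have : 0 ≤ ((σ * n + 2 * ν) * ‖symGrad V x‖ - 2 * ν * ‖symGrad W x‖) ^ 2 / (4 * ν) := by
      positivity
    linarith
  refine le_trans ?_ h3
  calc _ ≤ viscosity σ ν n (‖symGrad U x‖ ^ 2) * (‖symGrad V x‖ * ‖symGrad W x‖) :=
        mul_le_mul_of_nonneg_left h2 (by linarith)
    _ ≤ _ := mul_le_mul_of_nonneg_right h1 (by positivity)

theorem two_mul_strainSq_sub_le {σ ν : ℝ} (hσ : 0 ≤ σ) (hν : 0 < ν) {n : ℕ} (hn : 1 ≤ n)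
    (U V : SobolevPair Ω) :
    2 * ν * strainSq (U - V) ≤ formA σ ν n U U (U - V) - formA σ ν n V V (U - V) := by
  have hU := integrable_formA hσ hν hn U U (U - V)
  have hV := integrable_formA hσ hν hn V V (U - V)
  rw [strainSq, ← integral_const_mul, formA_eq, formA_eq, ← integral_sub hU hV]
  refine integral_mono_ae ((integrable_norm_sq_symGrad _).const_mul _) (hU.sub hV) ?_
  filter_upwards [symGrad_sub U V] with x hx
  rw [hx]
  exact two_mul_sq_norm_sub_le_viscosity hσ hn _ _

theorem integrable_potential {σ ν : ℝ} (hσ : 0 ≤ σ) (hν : 0 < ν) {n : ℕ} (hn : 1 ≤ n)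
    (V : SobolevPair Ω) :
    Integrable (fun x => potential σ ν n (‖symGrad V x‖ ^ 2)) (volume.restrict Ω) := by
  refine ((integrable_norm_sq_symGrad V).const_mul ((σ * n + 2 * ν) / 2)).mono' ?_
    (Filter.Eventually.of_forall fun x => ?_)
  · have hc : Continuous fun G : Mat d => potential σ ν n (‖G‖ ^ 2) := by
      simp only [potential_eq σ ν hn (sq_nonneg _)]
      fun_prop
    exact hc.comp_aestronglyMeasurable (memLp_symGrad V).1
  · have h0 : potential σ ν n 0 = 0 := by simp [potential]
    have hs := sq_nonneg ‖symGrad V x‖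
    -- The tangent at 0 gives the linear majorant φ(s) ≤ μ(0)s/2.
    have h1 := potential_sub_le hσ ν hn hs le_rfl
    have h2 := mul_le_mul_of_nonneg_right (viscosity_le hσ ν hn le_rfl) hs
    have h3 : 0 ≤ potential σ ν n (‖symGrad V x‖ ^ 2) := by
      rw [potential_eq σ ν hn hs]
      have : √((n ^ 2 : ℝ)⁻¹) ≤ √(‖symGrad V x‖ ^ 2 + (n ^ 2 : ℝ)⁻¹) :=
        Real.sqrt_le_sqrt (by linarith)
      have := mul_nonneg hσ (sub_nonneg.2 this)
      positivity
    rw [Real.norm_of_nonneg h3]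
    rw [h0] at h1
    linarith

/-- Since the potential is concave in `|D U|²`, energy differences are controlled by the energy
of the problem with frozen viscosity. -/
theorem energy_sub_le {σ ν : ℝ} (hσ : 0 ≤ σ) (hν : 0 < ν) {n : ℕ} (hn : 1 ≤ n)
    (f : L2Vec Ω) (U V : SobolevPair Ω) :
    energy σ ν n f U - energy σ ν n f V ≤
      formA σ ν n V V (U - V) + 1 / 2 * formA σ ν n V (U - V) (U - V) - load f (U - V) := by
  have hU := integrable_potential hσ hν hn U
  have hV := integrable_potential hσ hν hn V
  have h1 := integrable_formA hσ hν hn V V (U - V)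
  have h2 := (integrable_formA hσ hν hn V (U - V) (U - V)).const_mul (1 / 2)
  rw [energy, energy, load_sub, sub_sub_sub_comm, ← integral_sub hU hV, formA_eq, formA_eq,
    ← integral_const_mul, ← integral_add h1 h2]
  refine sub_le_sub_right (integral_mono_ae (hU.sub hV) (h1.add h2) ?_) _
  filter_upwards [symGrad_sub U V] with x hx
  refine (potential_sub_le hσ ν hn (sq_nonneg _) (sq_nonneg _)).trans_eq ?_
  -- Expanding |DU|² around DV splits the tangent bound into the linear and quadratic terms of the
  -- frozen form.
  have h : ‖symGrad U x‖ ^ 2 = ‖symGrad V x‖ ^ 2 +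
      2 * inner ℝ (symGrad V x) (symGrad U x - symGrad V x) +
        ‖symGrad U x - symGrad V x‖ ^ 2 := by
    rw [← norm_add_sq_real, add_sub_cancel]
  rw [Pi.add_apply, hx, real_inner_self_eq_norm_sq, h]
  ring

end Forms

/-! ### The Kačanov iteration -/

section Kacanov

variable {Ω : Set (Vec d)} {T : Triangulation Ω} {S : LocalSpaces T}

theorem zero_mem_pressureSpace (S : LocalSpaces T) : (0 : LInf Ω) ∈ pressureSpace S := by
  intro K _
  refine ⟨0, (S.PQ K).zero_mem, ?_⟩
  filter_upwards [Lp.coeFn_zero ℝ ∞ (volume.restrict Ω)] with x hx _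
  rw [hx]
  simp

theorem formB_eq_zero {V : SobolevPair Ω} (hV : V ∈ velocitySpace₀ S) {Q : LInf Ω}
    (hQ : Q ∈ pressureSpace S) : formB Q V = 0 := by
  rw [formB, hV.2 Q hQ, neg_zero]

theorem sub_mem_velocitySpace₀ (hΩb : Bornology.IsBounded Ω) {V W : SobolevPair Ω}
    (hV : V ∈ velocitySpace₀ S) (hW : W ∈ velocitySpace₀ S) : V - W ∈ velocitySpace₀ S := by
  refine ⟨(velocitySpace S).sub_mem hV.1 hW.1, fun Q hQ => ?_⟩
  have h := formB_sub_right hΩb Q V W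
  rw [formB_eq_zero hV hQ, formB_eq_zero hW hQ, formB] at h
  linarith

theorem IsKacanovStep.mem_velocitySpace₀ {σ ν : ℝ} {n : ℕ} {f : L2Vec Ω} {U U' : SobolevPair Ω}
    {P' : LInf Ω} (h : IsKacanovStep S σ ν n f U U' P') : U' ∈ velocitySpace₀ S := by
  refine ⟨h.1, fun Q hQ => ?_⟩
  -- Testing with zero velocity isolates the discrete divergence constraint.
  have := h.2.2 0 (velocitySpace S).zero_mem Q hQ
  rw [formA_zero_right, formB_zero_right, load_zero, formB] at this
  linarith

theorem IsKacanovStep.formA_eq_load {σ ν : ℝ} {n : ℕ} {f : L2Vec Ω} {U U' : SobolevPair Ω}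
    {P' : LInf Ω} (h : IsKacanovStep S σ ν n f U U' P') {V : SobolevPair Ω}
    (hV : V ∈ velocitySpace₀ S) : formA σ ν n U U' V = load f V := by
  have := h.2.2 V hV.1 0 (zero_mem_pressureSpace S)
  rwa [formB_zero_left, formB_eq_zero hV h.2.1.1, add_zero, add_zero] at this

/-- A discrete solution is a fixed point of the Kačanov iteration. -/
theorem IsDiscreteSolution.isKacanovStep {σ ν : ℝ} {n : ℕ} {f : L2Vec Ω} {U : SobolevPair Ω}
    {P : LInf Ω} (h : IsDiscreteSolution S σ ν n f U P) : IsKacanovStep S σ ν n f U U P := h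

/-- Strong monotonicity bounds the error by the residual a(V; V - V', V - U); Young's inequality
then absorbs half of the left side. -/
theorem strainSq_sub_solution_le (hΩb : Bornology.IsBounded Ω) {σ ν : ℝ} (hσ : 0 ≤ σ)
    (hν : 0 < ν) {n : ℕ} (hn : 1 ≤ n) {f : L2Vec Ω} {U V V' : SobolevPair Ω} {P P' : LInf Ω}
    (hU : IsDiscreteSolution S σ ν n f U P) (hV : V ∈ velocitySpace₀ S)
    (hV' : IsKacanovStep S σ ν n f V V' P') :
    strainSq (V - U) ≤ (σ * n + 2 * ν) ^ 2 / (4 * ν ^ 2) * strainSq (V' - V) := by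
  have he := sub_mem_velocitySpace₀ hΩb hV hU.isKacanovStep.mem_velocitySpace₀
  have h1 := two_mul_strainSq_sub_le hσ hν hn V U
  have h2 := formA_le_young hσ hν hn V (V - V') (V - U)
  have h3 : strainSq (V - V') = strainSq (V' - V) := by
    rw [strainSq_eq, strainSq_eq, ← neg_sub V' V, Prod.snd_neg, map_neg, norm_neg]
  rw [formA_sub_middle hσ hν hn, hV'.formA_eq_load he, h3] at h2
  rw [hU.isKacanovStep.formA_eq_load he] at h1
  have h4 : ν * strainSq (V - U) ≤ (σ * n + 2 * ν) ^ 2 / (4 * ν) * strainSq (V' - V) := by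
    linarith
  calc strainSq (V - U) = ν * strainSq (V - U) / ν := by field_simp
    _ ≤ (σ * n + 2 * ν) ^ 2 / (4 * ν) * strainSq (V' - V) / ν := by gcongr
    _ = _ := by field_simp

theorem norm12_sub_solution_le (hΩb : Bornology.IsBounded Ω) {σ ν : ℝ} (hσ : 0 ≤ σ)
    (hν : 0 < ν) {n : ℕ} (hn : 1 ≤ n) {f : L2Vec Ω} {U V V' : SobolevPair Ω} {P P' : LInf Ω}
    (hU : IsDiscreteSolution S σ ν n f U P) (hV : V ∈ velocitySpace₀ S)
    (hV' : IsKacanovStep S σ ν n f V V' P') :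
    norm12 (V - U) ≤ (σ * n + 2 * ν) / ν * norm12 (V' - V) := by
  have hc : 0 ≤ (σ * n + 2 * ν) / ν := by positivity
  refine le_of_sq_le_sq ?_ (mul_nonneg hc (norm12_nonneg _))
  have he := sub_mem_velocitySpace₀ hΩb hV hU.isKacanovStep.mem_velocitySpace₀
  have h := strainSq_sub_solution_le hΩb hσ hν hn hU hV hV'
  calc norm12 (V - U) ^ 2 ≤ 2 * strainSq (V - U) := korn he.1.1
    _ ≤ 2 * ((σ * n + 2 * ν) ^ 2 / (4 * ν ^ 2) * norm12 (V' - V) ^ 2) := by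
      have := mul_le_mul_of_nonneg_left (strainSq_le (V' - V))
        (show 0 ≤ (σ * n + 2 * ν) ^ 2 / (4 * ν ^ 2) by positivity)
      linarith
    -- Korn's factor 2 against the 4 in the strain estimate leaves a spare factor 1/2.
    _ = 1 / 2 * (((σ * n + 2 * ν) / ν) * norm12 (V' - V)) ^ 2 := by
      field_simp
      ring
    _ ≤ _ := by
      have := sq_nonneg ((σ * n + 2 * ν) / ν * norm12 (V' - V))
      linarith

/-- The step V' minimises the quadratic energy frozen at V. The linear terms therefore collapse to
-a(V; δ, δ) with δ = V' - V, and adding the quadratic term leaves -½ a(V; δ, δ). -/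
theorem energy_decrease (hΩb : Bornology.IsBounded Ω) {σ ν : ℝ} (hσ : 0 ≤ σ)
    (hν : 0 < ν) {n : ℕ} (hn : 1 ≤ n) {f : L2Vec Ω} {V V' : SobolevPair Ω} {P' : LInf Ω}
    (hV : V ∈ velocitySpace₀ S) (hV' : IsKacanovStep S σ ν n f V V' P') :
    ν * strainSq (V' - V) ≤ energy σ ν n f V - energy σ ν n f V' := by
  have hδ := sub_mem_velocitySpace₀ hΩb hV'.mem_velocitySpace₀ hV
  have h1 := energy_sub_le hσ hν hn f V' V
  have h2 := formA_sub_middle hσ hν hn V V' V (V' - V)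
  have h3 := two_mul_strainSq_le_formA hσ hν hn V (V' - V)
  rw [hV'.formA_eq_load hδ] at h2
  linarith

/-- With the tangent taken at the solution, the linear terms cancel by the Galerkin equation and
only ½ a(U; V - U, V - U) remains. -/
theorem energy_sub_solution_le (hΩb : Bornology.IsBounded Ω) {σ ν : ℝ} (hσ : 0 ≤ σ)
    (hν : 0 < ν) {n : ℕ} (hn : 1 ≤ n) {f : L2Vec Ω} {U V : SobolevPair Ω} {P : LInf Ω}
    (hU : IsDiscreteSolution S σ ν n f U P) (hV : V ∈ velocitySpace₀ S) :
    energy σ ν n f V - energy σ ν n f U ≤ (σ * n + 2 * ν) / 2 * strainSq (V - U) := by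
  have he := sub_mem_velocitySpace₀ hΩb hV hU.isKacanovStep.mem_velocitySpace₀
  have h1 := energy_sub_le hσ hν hn f V U
  have h2 := formA_self_le hσ hν hn U (V - U)
  rw [hU.isKacanovStep.formA_eq_load he] at h1
  linarith

/-- The estimates yield the rate 8ν³/(σn + 2ν)³. The stated rate is smaller because √3 ≥ 1, the only
property of √3 that enters. -/
theorem contraction_rate_bounds {σ ν : ℝ} (hσ : 0 ≤ σ) (hν : 0 < ν) (n : ℕ) :
    0 < ν ^ 3 / ((√3 * σ * n + 2 * ν) * (σ * n + 2 * ν) ^ 2) ∧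
      ν ^ 3 / ((√3 * σ * n + 2 * ν) * (σ * n + 2 * ν) ^ 2) ≤
        8 * ν ^ 3 / (σ * n + 2 * ν) ^ 3 ∧
      ν ^ 3 / ((√3 * σ * n + 2 * ν) * (σ * n + 2 * ν) ^ 2) < 1 := by
  have hx : 0 ≤ σ * n := by positivity
  have h3 : 1 ≤ √(3 : ℝ) := Real.one_le_sqrt.2 (by norm_num)
  have hy : σ * n ≤ √3 * σ * n := by
    rw [mul_assoc]
    exact le_mul_of_one_le_left hx h3
  generalize √3 * σ * n = y at *
  generalize σ * n = x at *
  have hxp : 0 < x + 2 * ν := by linarith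
  have hyp : 0 < y + 2 * ν := by linarith
  refine ⟨by positivity, ?_, ?_⟩
  · rw [div_le_div_iff₀ (by positivity) (by positivity)]
    have : 0 ≤ ν ^ 3 * (x + 2 * ν) ^ 2 * (8 * (y + 2 * ν) - (x + 2 * ν)) :=
      mul_nonneg (by positivity) (by linarith)
    linarith
  · rw [div_lt_one (by positivity)]
    calc ν ^ 3 < (2 * ν) * (2 * ν) ^ 2 := by
          have : 0 < ν ^ 3 := by positivity
          linarith
      _ ≤ _ := by gcongr <;> linarith

theorem energy_contraction (hΩb : Bornology.IsBounded Ω) {σ ν : ℝ} (hσ : 0 ≤ σ)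
    (hν : 0 < ν) {n : ℕ} (hn : 1 ≤ n) {f : L2Vec Ω} {U V V' : SobolevPair Ω} {P P' : LInf Ω}
    (hU : IsDiscreteSolution S σ ν n f U P) (hV : V ∈ velocitySpace₀ S)
    (hV' : IsKacanovStep S σ ν n f V V' P') :
    energy σ ν n f V' - energy σ ν n f U ≤
      qCon σ ν n * (energy σ ν n f V - energy σ ν n f U) := by
  have h1 := energy_decrease hΩb hσ hν hn hV hV'
  have h2 := energy_sub_solution_le hΩb hσ hν hn hU hV
  have h3 := strainSq_sub_solution_le hΩb hσ hν hn hU hV hV'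
  obtain ⟨hr, hr', -⟩ := contraction_rate_bounds hσ hν n
  rw [qCon]
  generalize ν ^ 3 / ((√3 * σ * n + 2 * ν) * (σ * n + 2 * ν) ^ 2) = r at *
  have hc : 0 < σ * n + 2 * ν := by positivity
  have h4 : r * (energy σ ν n f V - energy σ ν n f U) ≤
      energy σ ν n f V - energy σ ν n f V' := by
    -- Positivity of r suffices here: the sign of the energy gap plays no role, so minimality of U
    -- need not be shown.
    calc _ ≤ r * ((σ * n + 2 * ν) / 2 *
          ((σ * n + 2 * ν) ^ 2 / (4 * ν ^ 2) * strainSq (V' - V))) := by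
          gcongr
          exact h2.trans (by gcongr)
      _ ≤ 8 * ν ^ 3 / (σ * n + 2 * ν) ^ 3 * ((σ * n + 2 * ν) / 2 *
          ((σ * n + 2 * ν) ^ 2 / (4 * ν ^ 2) * strainSq (V' - V))) := by
          have := strainSq_nonneg (V' - V)
          gcongr
      _ = ν * strainSq (V' - V) := by field_simp; ring
      _ ≤ _ := h1
  linarith

end Kacanov

end BinghamFE

/-! ### Error bound and energy contraction along the iteration -/

theorem mainTheorem2 {d : ℕ} (hd : d = 2 ∨ d = 3)
    (Ω : Set (BinghamFE.Vec d)) (hΩ : IsOpen Ω) (hΩb : Bornology.IsBounded Ω)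
    (T : BinghamFE.Triangulation Ω) (S : BinghamFE.LocalSpaces T)
    (σ ν : ℝ) (hσ : 0 ≤ σ) (hν : 0 < ν) (n : ℕ) (hn : 1 ≤ n)
    (f : BinghamFE.L2Vec Ω)
    (U : BinghamFE.SobolevPair Ω) (P : BinghamFE.LInf Ω)
    (hU : BinghamFE.IsDiscreteSolution S σ ν n f U P)
    (Uit : ℕ → BinghamFE.SobolevPair Ω) (Pit : ℕ → BinghamFE.LInf Ω)
    (h0 : Uit 0 ∈ BinghamFE.velocitySpace₀ S)
    (hit : ∀ l, BinghamFE.IsKacanovStep S σ ν n f (Uit l) (Uit (l + 1)) (Pit (l + 1))) :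
    (∀ l, BinghamFE.norm12 (Uit l - U) ≤
      (σ * n + 2 * ν) / ν * BinghamFE.norm12 (Uit (l + 1) - Uit l)) ∧
    (∀ l, BinghamFE.energy σ ν n f (Uit (l + 1)) - BinghamFE.energy σ ν n f U ≤
      BinghamFE.qCon σ ν n *
        (BinghamFE.energy σ ν n f (Uit l) - BinghamFE.energy σ ν n f U)) ∧
    BinghamFE.qCon σ ν n ∈ Set.Ioo (0 : ℝ) 1 := by
  -- Only the initial iterate needs the divergence constraint as an assumption; each step enforces
  -- it on its output.
  have hmem : ∀ l, Uit l ∈ BinghamFE.velocitySpace₀ S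
    | 0 => h0
    | l + 1 => (hit l).mem_velocitySpace₀
  obtain ⟨hr, -, hr'⟩ := BinghamFE.contraction_rate_bounds hσ hν n
  refine ⟨fun l => BinghamFE.norm12_sub_solution_le hΩb hσ hν hn hU (hmem l) (hit l),
    fun l => BinghamFE.energy_contraction hΩb hσ hν hn hU (hmem l) (hit l), ?_, ?_⟩
  · rw [BinghamFE.qCon]
    linarith
  · rw [BinghamFE.qCon]
    linarith
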